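/- Let $R$ be an associative ring with unit. An $\mathcal R$-module is a covariant additive functor $\mathbb M$ from left $R$-modules to abelian groups; morphisms are natural transformations, and kernels, products, direct limits, monomorphisms and epimorphisms are taken pointwise. A right $R$-module $N$ defines the quasi-coherent $\mathcal R$-module $\mathcal N(S)=N\otimes_R S$. The dual of $\mathbb M$ is the functor on right $R$-modules $\mathbb M^*(N)=\operatorname{Hom}_{\mathcal R}(\mathbb M,\mathcal N)$; a morphism $f\colon\mathbb F\to\mathbb M$ induces the dual morphism $f^*\colon\mathbb M^*\to\mathbb F^*$, $w\mapsto w\circ f$. Suppose that $\mathbb M$ preserves direct limits (colimits of direct systems indexed by upward directed sets). Call $\mathbb M$ an FP module if, for every family $\{S_i\}_{i\in I}$ of $R$-modules indexed by a set, the natural map $\mathbb M(\prod_i S_i)\to\prod_i\mathbb M(S_i)$ is bijective, and an ML module if this map is always injective. Call $\mathbb M$ an SML module if it is an ML module and, for every FP submodule $\mathbb F\subseteq\mathbb M$ (that is, subfunctor $\mathbb F$ which preserves direct limits and direct products), the dual morphism $\mathbb M^*\to\mathbb F^*$ is an epimorphism. Theorem. Let $\mathbb M$ be an $\mathcal R$-module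 that preserves direct limits. The following statements are equivalent: 1. $\mathbb M$ is an SML module. 2. There is a direct system $\{\mathbb F_i\}_{i\in I}$ of FP submodules of $\mathbb M$, indexed by an upward directed set, such that $\mathbb M=\varinjlim_{i\in I}\mathbb F_i$ and the dual morphism $\mathbb M^*\to\mathbb F_i^*$ is an epimorphism for every $i\in I$. 3. There exist a family $\{P_j\}_{j\in J}$ of finitely presented right $R$-modules, indexed by a set, and a monomorphism $\mathbb M\to\prod_{j\in J}\mathcal P_j$. -/

import Mathlib

universe u

open CategoryTheory CategoryTheory.Limits Opposite
open scoped TensorProduct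

namespace FunctorialModules

noncomputable section

/-! Throughout, `R` is an associative ring with unit, left `R`-modules are the objects of
`ModuleCat R`, and right `R`-modules are the objects of `ModuleCat Rᵐᵒᵖ`
(with `n · r = MulOpposite.op r • n`). -/

section Tensor

variable (R : Type u) [Ring R]

/-- The relations `(n · r) ⊗ s = n ⊗ (r · s)` inside `N ⊗_ℤ S`, for a right `R`-module `N` and a
left `R`-module `S`. -/
def balancedRel (N S : Type u) [AddCommGroup N] [Module Rᵐᵒᵖ N] [AddCommGroup S] [Module R S] :
    AddSubgroup (N ⊗[ℤ] S) :=
  AddSubgroup.closure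
    {t | ∃ (n : N) (r : R) (s : S), t = (MulOpposite.op r • n) ⊗ₜ[ℤ] s - n ⊗ₜ[ℤ] (r • s)}

/-- The tensor product `N ⊗_R S` of a right module and a left module over a ring that need not be
commutative; it is an abelian group. -/
abbrev BalancedTensor (N S : Type u) [AddCommGroup N] [Module Rᵐᵒᵖ N] [AddCommGroup S]
    [Module R S] : Type u :=
  (N ⊗[ℤ] S) ⧸ balancedRel R N S

variable {R}

/-- The homomorphism `n ⊗ s ↦ f n ⊗ g s`. -/
def BalancedTensor.map {N N' S S' : Type u} [AddCommGroup N] [Module Rᵐᵒᵖ N]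
    [AddCommGroup N'] [Module Rᵐᵒᵖ N'] [AddCommGroup S] [Module R S] [AddCommGroup S']
    [Module R S'] (f : N →ₗ[Rᵐᵒᵖ] N') (g : S →ₗ[R] S') :
    BalancedTensor R N S →+ BalancedTensor R N' S' :=
  QuotientAddGroup.map _ _
    (TensorProduct.map f.toAddMonoidHom.toIntLinearMap g.toAddMonoidHom.toIntLinearMap).toAddMonoidHom
    (by
      rw [balancedRel, AddSubgroup.closure_le]
      rintro _ ⟨n, r, s, rfl⟩
      refine AddSubgroup.subset_closure ⟨f n, r, g s, ?_⟩
      simp)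

theorem BalancedTensor.hom_ext {N S : Type u} [AddCommGroup N] [Module Rᵐᵒᵖ N] [AddCommGroup S]
    [Module R S] {A : Type*} [AddCommGroup A] {φ ψ : BalancedTensor R N S →+ A}
    (h : ∀ (n : N) (s : S), φ (QuotientAddGroup.mk (n ⊗ₜ[ℤ] s)) =
      ψ (QuotientAddGroup.mk (n ⊗ₜ[ℤ] s))) : φ = ψ := by
  refine QuotientAddGroup.addMonoidHom_ext _ ?_
  ext t
  induction t using TensorProduct.induction_on with
  | zero => simp
  | tmul n s => exact h n s
  | add x y hx hy => rw [map_add, map_add, hx, hy]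

theorem BalancedTensor.map_mk {N N' S S' : Type u} [AddCommGroup N] [Module Rᵐᵒᵖ N]
    [AddCommGroup N'] [Module Rᵐᵒᵖ N'] [AddCommGroup S] [Module R S] [AddCommGroup S']
    [Module R S'] (f : N →ₗ[Rᵐᵒᵖ] N') (g : S →ₗ[R] S') (n : N) (s : S) :
    BalancedTensor.map f g (QuotientAddGroup.mk (n ⊗ₜ[ℤ] s)) =
      QuotientAddGroup.mk (f n ⊗ₜ[ℤ] g s) := rfl

end Tensor

variable (R : Type u) [Ring R]

/-- The functor `N ↦ (S ↦ N ⊗_R S)` which sends a right `R`-module `N` to the quasi-coherent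
functor associated with it. -/
def quasiCoherent : ModuleCat.{u} Rᵐᵒᵖ ⥤ ModuleCat.{u} R ⥤ AddCommGrpCat.{u} where
  obj N :=
    { obj S := AddCommGrpCat.of (BalancedTensor R N S)
      map g := AddCommGrpCat.ofHom (BalancedTensor.map LinearMap.id g.hom)
      map_id S := by
        ext1
        exact BalancedTensor.hom_ext fun _ _ => rfl
      map_comp g g' := by
        ext1
        exact BalancedTensor.hom_ext fun _ _ => rfl }
  map f :=
    { app S := AddCommGrpCat.ofHom (BalancedTensor.map f.hom LinearMap.id)
      naturality S S' g := by
        ext1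
        exact BalancedTensor.hom_ext fun _ _ => rfl }
  map_id N := by
    ext S : 2
    ext1
    exact BalancedTensor.hom_ext fun _ _ => rfl
  map_comp f f' := by
    ext S : 2
    ext1
    exact BalancedTensor.hom_ext fun _ _ => rfl

variable {R}

/-- The dual `M*` of a functor `M` on left `R`-modules: the functor
`N ↦ Hom(M, N ⊗_R -)` on right `R`-modules, with the pointwise addition of natural
transformations. -/
def dual (M : ModuleCat.{u} R ⥤ AddCommGrpCat.{u}) :
    ModuleCat.{u} Rᵐᵒᵖ ⥤ AddCommGrpCat.{u + 1} :=
  quasiCoherent R ⋙ preadditiveCoyoneda.obj (op M)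

/-- The dual morphism `f* : M* ⟶ F*`, `w ↦ w ∘ f`, of a morphism `f : F ⟶ M`. -/
def dualMap {F M : ModuleCat.{u} R ⥤ AddCommGrpCat.{u}} (f : F ⟶ M) : dual M ⟶ dual F :=
  Functor.whiskerLeft (quasiCoherent R) (preadditiveCoyoneda.map f.op)

/-- `M` preserves direct limits, i.e. colimits of direct systems indexed by upward directed
sets. -/
def PreservesDirectLimits (M : ModuleCat.{u} R ⥤ AddCommGrpCat.{u}) : Prop :=
  ∀ (I : Type u) [Preorder I] [IsDirectedOrder I] [Nonempty I], PreservesColimitsOfShape I M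

/-- The natural map `M (∏ i, S i) → ∏ i, M (S i)`. -/
def toProd (M : ModuleCat.{u} R ⥤ AddCommGrpCat.{u}) {I : Type u} (S : I → ModuleCat.{u} R)
    (x : M.obj (ModuleCat.of R (∀ i, S i))) (i : I) : M.obj (S i) :=
  M.map (ModuleCat.ofHom (LinearMap.proj i : (∀ i, S i) →ₗ[R] S i)) x

/-- FP functors: additive, preserving direct limits and direct products. -/
structure IsFP (F : ModuleCat.{u} R ⥤ AddCommGrpCat.{u}) : Prop where
  additive : F.Additive
  preservesDirectLimits : PreservesDirectLimits F
  bijective_toProd : ∀ {I : Type u} (S : I → ModuleCat.{u} R), Function.Bijective (toProd F S)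

/-- ML functors. -/
structure IsML (M : ModuleCat.{u} R ⥤ AddCommGrpCat.{u}) : Prop where
  additive : M.Additive
  preservesDirectLimits : PreservesDirectLimits M
  injective_toProd : ∀ {I : Type u} (S : I → ModuleCat.{u} R), Function.Injective (toProd M S)

/-- SML functors: ML functors `M` such that `M* ⟶ F*` is an epimorphism for every FP
subfunctor `F` of `M`. -/
structure IsSML (M : ModuleCat.{u} R ⥤ AddCommGrpCat.{u}) : Prop where
  isML : IsML M
  epi_dualMap : ∀ (F : ModuleCat.{u} R ⥤ AddCommGrpCat.{u}) (i : F ⟶ M),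
    Mono i → IsFP F → Epi (dualMap i)

/-- `M` is the direct limit of a direct system of FP subfunctors `F i` such that every
`M* ⟶ (F i)*` is an epimorphism. -/
def IsDirectLimitOfDualEpiFP (M : ModuleCat.{u} R ⥤ AddCommGrpCat.{u}) : Prop :=
  ∃ (I : Type u) (_ : Preorder I) (_ : IsDirectedOrder I) (_ : Nonempty I)
    (F : I ⥤ ModuleCat.{u} R ⥤ AddCommGrpCat.{u}) (ι : F ⟶ (Functor.const I).obj M),
    Nonempty (IsColimit (Cocone.mk M ι)) ∧
      ∀ i : I, IsFP (F.obj i) ∧ Mono (ι.app i) ∧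
        Epi (dualMap (ι.app i : F.obj i ⟶ M))

/-- `M` embeds in a product of quasi-coherent functors of finitely presented right modules. -/
def EmbedsInProdFinitelyPresented (M : ModuleCat.{u} R ⥤ AddCommGrpCat.{u}) : Prop :=
  ∃ (J : Type u) (P : J → ModuleCat.{u} Rᵐᵒᵖ)
    (f : M ⟶ ∏ᶜ fun j => (quasiCoherent R).obj (P j)),
    (∀ j, Module.FinitePresentation Rᵐᵒᵖ (P j)) ∧ Mono f

end

end FunctorialModules

/-! Every left module is a filtered colimit of finitely presented ones taken from a fixed set, so a
functor that also preserves products is generated by a single element `y` of its value at a finitely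
presented `A`. The morphisms killing `y` are those that factor through a single `g : A ⟶ B` with `B`
finitely presented. Transposing presentations of `A` and `B` turns `g` into a finitely presented
right module `P` with a tensor `t` in `P ⊗ A` that is killed by exactly the same morphisms, so
`y ↦ t` embeds the functor in `P ⊗ -`. Moreover every element of `N ⊗ A` killed by whatever kills
`t` is the image of `t` under a map `P → N`. Hence every morphism to `N ⊗ -` extends along an
embedding of an FP functor in `P ⊗ -`.

An SML functor is the directed union of its subfunctors with one generator, which are FP. If each
FP member of a direct system embeds in some `Pᵢ ⊗ -`, the extensions of these embeddings to the
direct limit are jointly injective. Conversely, a family of morphisms on an FP functor `F` which is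
jointly injective has a finite jointly injective subfamily: otherwise there are elements `z_E ≠ 0`
killed by the members of `E`, for every finite `E`, and the family `(z_E)` defines an element of `F`
at the module of germs of families along the finite sets `E`, which is killed by all the morphisms
but is not zero. So an FP subfunctor of a product of functors `Pⱼ ⊗ -` embeds in `P ⊗ -` for a
finite direct sum `P` of the `Pⱼ`, and the extension property applies. -/

namespace FunctorialModules

section LocallyFinitelyPresented

open Cardinal ObjectProperty

attribute [local instance] fact_isRegular_aleph0

variable (R : Type u) [Ring R]

theorem isFinitelyPresentable_self : IsFinitelyPresentable.{u} (ModuleCat.of R R) := by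
  rw [isFinitelyPresentable_iff_preservesFilteredColimits]
  let e : coyoneda.obj (op (ModuleCat.of R R)) ≅ forget (ModuleCat.{u} R) :=
    NatIso.ofComponents
      (fun S => (ModuleCat.homEquiv.trans (LinearMap.ringLmapEquivSelf R ℤ S).toEquiv).toIso)
      (fun _ => rfl)
  exact ⟨fun _ _ _ => preservesColimitsOfShape_of_natIso e.symm⟩

theorem isStrongGenerator_singleton_self :
    (ObjectProperty.singleton (ModuleCat.of R R)).IsStrongGenerator := by
  refine isStrongGenerator_iff.2 ⟨?_, fun S T i _ hi => ?_⟩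
  · intro S T f g h
    ext x
    simpa using ConcreteCategory.congr_hom
      (h _ ⟨⟨⟩⟩ (ModuleCat.ofHom (LinearMap.toSpanSingleton R S x))) (1 : R)
  · have : Epi i := (ModuleCat.epi_iff_surjective i).2 fun y => by
      obtain ⟨h, hh⟩ := hi _ ⟨⟨⟩⟩ (ModuleCat.ofHom (LinearMap.toSpanSingleton R T y))
      exact ⟨h (1 : R), (ConcreteCategory.congr_hom hh (1 : R)).trans (one_smul R y)⟩
    exact isIso_of_mono_of_epi i

variable {R}

theorem finitePresentation_biproduct {ι : Type u} [Finite ι] (A : ι → ModuleCat.{u} R)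
    [∀ i, Module.FinitePresentation R (A i)] :
    Module.FinitePresentation R (⨁ A : ModuleCat.{u} R) :=
  .of_equiv (biproduct.isoProduct A ≪≫ ModuleCat.piIsoPi A).toLinearEquiv.symm

theorem finitePresentation_coproduct {ι : Type u} [Finite ι] (A : ι → ModuleCat.{u} R)
    [∀ i, Module.FinitePresentation R (A i)] :
    Module.FinitePresentation R (∐ A : ModuleCat.{u} R) :=
  have := finitePresentation_biproduct A
  .of_equiv (biproduct.isoCoproduct A).toLinearEquiv

theorem finitePresentation_quotient_range {A B : Type u} [AddCommGroup A] [Module R A]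
    [AddCommGroup B] [Module R B] [Module.Finite R A] [Module.FinitePresentation R B]
    (f : A →ₗ[R] B) : Module.FinitePresentation R (B ⧸ LinearMap.range f) :=
  Module.finitePresentation_of_surjective (Submodule.mkQ _) (Submodule.mkQ_surjective _) (by
    rw [Submodule.ker_mkQ, LinearMap.range_eq_map]
    exact Module.Finite.fg_top.map f)

theorem finitePresentation_of_isColimit {J : Type u} [SmallCategory J] [FinCategory J]
    {D : J ⥤ ModuleCat.{u} R} {c : Cocone D} (hc : IsColimit c)
    [∀ j, Module.FinitePresentation R (D.obj j)] : Module.FinitePresentation R c.pt := by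
  let s : (∐ fun f : Σ p : J × J, p.1 ⟶ p.2 => D.obj f.1.1) ⟶ ∐ D.obj :=
    Sigma.desc fun f => D.map f.2 ≫ Sigma.ι D.obj f.1.2
  let t : (∐ fun f : Σ p : J × J, p.1 ⟶ p.2 => D.obj f.1.1) ⟶ ∐ D.obj :=
    Sigma.desc fun f => Sigma.ι D.obj f.1.1
  have hcoker := HasColimitOfHasCoproductsOfHasCoequalizers.buildIsColimit s t
    (by simp [s, Sigma.ι]) (by simp [t, Sigma.ι]) (colimit.isColimit _) (colimit.isColimit _)
    (Preadditive.isColimitCoforkOfCokernelCofork (ModuleCat.cokernelIsColimit (s - t)))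
  have := finitePresentation_coproduct D.obj
  have := finitePresentation_coproduct fun f : Σ p : J × J, p.1 ⟶ p.2 => D.obj f.1.1
  have hquot := finitePresentation_quotient_range (s - t).hom
  exact @Module.FinitePresentation.of_equiv _ _ _ _ _ _ _ _
    (hcoker.coconePointUniqueUpToIso hc).toLinearEquiv hquot

variable (R)

theorem singleton_self_le_isCardinalPresentable :
    ObjectProperty.singleton (ModuleCat.of R R) ≤
      isCardinalPresentable _ (ℵ₀ : Cardinal.{u}) := by
  rintro _ ⟨⟩
  exact isFinitelyPresentable_self R

theorem isCardinalPresentable_le_finitePresentation :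
    isCardinalPresentable (ModuleCat.{u} R) (ℵ₀ : Cardinal.{u}) ≤
      fun A : ModuleCat.{u} R => Module.FinitePresentation R A := by
  rw [IsStrongGenerator.colimitsCardinalClosure_eq_isCardinalPresentable
    (isStrongGenerator_singleton_self R) (singleton_self_le_isCardinalPresentable R)]
  have : IsClosedUnderIsomorphisms fun A : ModuleCat.{u} R => Module.FinitePresentation R A :=
    ⟨fun e _ => .of_equiv e.toLinearEquiv⟩
  refine colimitsCardinalClosure_le _ _ (fun J _ hJ => ⟨?_⟩) ?_
  · rintro A ⟨p⟩
    have : FinCategory J :=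
      ((Arrow.finite_iff J).1 ((hasCardinalLT_aleph0_iff _).1 hJ)).some
    have := p.prop_diag_obj
    exact finitePresentation_of_isColimit p.isColimit
  · rintro _ ⟨⟩
    exact inferInstanceAs (Module.FinitePresentation R R)

theorem exists_filteredGenerator : ∃ (ι : Type u) (G : ι → ModuleCat.{u} R),
    (∀ i, Module.FinitePresentation R (G i)) ∧
      (ofObj G).IsCardinalFilteredGenerator (ℵ₀ : Cardinal.{u}) := by
  have : IsCardinalLocallyPresentable (ModuleCat.{u} R) ℵ₀ :=
    (IsCardinalLocallyPresentable.iff_exists_isStrongGenerator _ _).2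
      ⟨_, inferInstance, isStrongGenerator_singleton_self R,
        singleton_self_le_isCardinalPresentable R⟩
  obtain ⟨P, _, hP⟩ := HasCardinalFilteredGenerator.exists_small_generator (ModuleCat.{u} R) ℵ₀
  have hfp := hP.le_isCardinalPresentable.trans (isCardinalPresentable_le_finitePresentation R)
  refine ⟨Shrink (Subtype P), fun i => ((equivShrink _).symm i).1,
    fun i => hfp _ ((equivShrink _).symm i).2, ?_⟩
  suffices ofObj (fun i => ((equivShrink (Subtype P)).symm i).1) = P by
    rwa [this]
  ext A
  rw [ofObj_iff]
  exact ⟨by rintro ⟨i, rfl⟩; exact ((equivShrink _).symm i).2,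
    fun hA => ⟨equivShrink _ ⟨A, hA⟩, by rw [Equiv.symm_apply_apply]⟩⟩

/-- The index type of a set of finitely presented left `R`-modules such that every left
`R`-module is a filtered colimit of members of it. -/
def FPIndex : Type u := (exists_filteredGenerator R).choose

variable {R}

/-- The modules of the set indexed by `FPIndex R`. -/
noncomputable def fpModule : FPIndex R → ModuleCat.{u} R :=
  (exists_filteredGenerator R).choose_spec.choose

instance (i : FPIndex R) : Module.FinitePresentation R (fpModule i) :=
  (exists_filteredGenerator R).choose_spec.choose_spec.1 i

variable (R) in
theorem isCardinalFilteredGenerator_fpModule :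
    (ofObj (fpModule (R := R))).IsCardinalFilteredGenerator (ℵ₀ : Cardinal.{u}) :=
  (exists_filteredGenerator R).choose_spec.choose_spec.2

instance (i : FPIndex R) : IsFinitelyPresentable.{u} (fpModule i) :=
  (isCardinalFilteredGenerator_fpModule R).le_isCardinalPresentable _ (ofObj_apply fpModule i)

end LocallyFinitelyPresented

section Approximation

open Cardinal ObjectProperty

attribute [local instance] fact_isRegular_aleph0

variable {R : Type u} [Ring R] {F : ModuleCat.{u} R ⥤ AddCommGrpCat.{u}}

theorem PreservesDirectLimits.preservesColimitsOfShape (hF : PreservesDirectLimits F)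
    (J : Type u) [SmallCategory J] [IsFiltered J] : PreservesColimitsOfShape J F := by
  obtain ⟨I, _, _, _, e, _⟩ := IsFiltered.exists_directed J
  have := hF I
  exact Functor.Final.preservesColimitsOfShape_of_final e _

theorem exists_map_eq_zero_of_isColimit {J : Type u} [SmallCategory J] [IsFiltered J]
    {D : J ⥤ AddCommGrpCat.{u}} {c : Cocone D} (hc : IsColimit c) {j : J} (y : D.obj j)
    (hy : c.ι.app j y = 0) : ∃ (k : J) (f : j ⟶ k), D.map f y = 0 := by
  obtain ⟨k, f, h⟩ := (hc.eq_iff' y 0).1 (by rw [hy, map_zero])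
  exact ⟨k, f, by rw [h, map_zero]⟩

theorem map_comp_apply {S T U : ModuleCat.{u} R} (f : S ⟶ T) (g : T ⟶ U) (x : F.obj S) :
    F.map (f ≫ g) x = F.map g (F.map f x) := by
  rw [F.map_comp, ConcreteCategory.comp_apply]

theorem exists_filtered_fpModule_presentation (S : ModuleCat.{u} R) :
    ∃ (J : Type u) (_ : SmallCategory J) (_ : IsFiltered J) (D : J ⥤ ModuleCat.{u} R)
      (c : D ⟶ (Functor.const J).obj S), Nonempty (IsColimit (Cocone.mk S c)) ∧
        ∀ j, ∃ i, Nonempty (D.obj j ≅ fpModule i) := by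
  obtain ⟨J, _, _, ⟨p⟩⟩ := (isCardinalFilteredGenerator_fpModule R).exists_colimitsOfShape S
  refine ⟨J, _, isFiltered_of_isCardinalFiltered J ℵ₀, p.diag, p.ι, ⟨p.isColimit⟩, fun j => ?_⟩
  obtain ⟨i, hi⟩ := (ofObj_iff _ _).1 (p.prop_diag_obj j)
  exact ⟨i, ⟨eqToIso hi.symm⟩⟩

theorem PreservesDirectLimits.exists_fpModule_rep (hF : PreservesDirectLimits F)
    (S : ModuleCat.{u} R) (z : F.obj S) :
    ∃ (i : FPIndex R) (k : fpModule i ⟶ S) (b : F.obj (fpModule i)), F.map k b = z := by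
  obtain ⟨J, _, _, D, c, ⟨hc⟩, hD⟩ := exists_filtered_fpModule_presentation S
  have := hF.preservesColimitsOfShape J
  obtain ⟨j, b, rfl⟩ := Concrete.isColimit_exists_rep _ (isColimitOfPreserves F hc) z
  obtain ⟨i, ⟨e⟩⟩ := hD j
  refine ⟨i, e.inv ≫ c.app j, F.map e.hom b, ?_⟩
  rw [← map_comp_apply, e.hom_inv_id_assoc]
  rfl

theorem PreservesDirectLimits.exists_fpModule_factor (hF : PreservesDirectLimits F)
    {A S : ModuleCat.{u} R} [IsFinitelyPresentable.{u} A] (h : A ⟶ S) (y : F.obj A)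
    (hy : F.map h y = 0) : ∃ (i : FPIndex R) (g : A ⟶ fpModule i) (k : fpModule i ⟶ S),
      g ≫ k = h ∧ F.map g y = 0 := by
  obtain ⟨J, _, _, D, c, ⟨hc⟩, hD⟩ := exists_filtered_fpModule_presentation S
  have := hF.preservesColimitsOfShape J
  obtain ⟨j, g, rfl⟩ := IsFinitelyPresentable.exists_hom_of_isColimit hc h
  obtain ⟨k, f, hf⟩ := exists_map_eq_zero_of_isColimit (isColimitOfPreserves F hc) (F.map g y)
    ((map_comp_apply _ _ _).symm.trans hy)
  obtain ⟨i, ⟨e⟩⟩ := hD k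
  refine ⟨i, g ≫ D.map f ≫ e.hom, e.inv ≫ c.app k, ?_, ?_⟩
  · simp only [Category.assoc, e.hom_inv_id_assoc]
    exact congrArg (g ≫ ·) ((Cocone.mk S c).w f)
  · rw [map_comp_apply, map_comp_apply]
    exact (congrArg (F.map e.hom) hf).trans (map_zero (F.map e.hom).hom)

end Approximation

section BalancedTensor

/-- The class `n ⊗ s` in the balanced tensor product `N ⊗_R S`. -/
abbrev BalancedTensor.tmul (R : Type u) [Ring R] {N S : Type u} [AddCommGroup N] [Module Rᵐᵒᵖ N]
    [AddCommGroup S] [Module R S] (n : N) (s : S) : BalancedTensor R N S :=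
  QuotientAddGroup.mk (n ⊗ₜ[ℤ] s)

namespace BalancedTensor

variable {R : Type u} [Ring R] {N N' N'' S S' S'' : Type u}
  [AddCommGroup N] [Module Rᵐᵒᵖ N] [AddCommGroup N'] [Module Rᵐᵒᵖ N']
  [AddCommGroup N''] [Module Rᵐᵒᵖ N''] [AddCommGroup S] [Module R S]
  [AddCommGroup S'] [Module R S'] [AddCommGroup S''] [Module R S'']

theorem smul_tmul (n : N) (r : R) (s : S) :
    tmul R (MulOpposite.op r • n) s = tmul R n (r • s) :=
  QuotientAddGroup.eq_iff_sub_mem.2 (AddSubgroup.subset_closure ⟨n, r, s, rfl⟩)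

theorem add_tmul (n n' : N) (s : S) : tmul R (n + n') s = tmul R n s + tmul R n' s :=
  congrArg QuotientAddGroup.mk (TensorProduct.add_tmul n n' s)

theorem tmul_add (n : N) (s s' : S) : tmul R n (s + s') = tmul R n s + tmul R n s' :=
  congrArg QuotientAddGroup.mk (TensorProduct.tmul_add n s s')

theorem zero_tmul (s : S) : tmul R (0 : N) s = 0 :=
  congrArg QuotientAddGroup.mk (TensorProduct.zero_tmul N s)

theorem tmul_zero (n : N) : tmul R n (0 : S) = 0 :=
  congrArg QuotientAddGroup.mk (TensorProduct.tmul_zero S n)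

theorem sum_tmul {ι : Type*} (t : Finset ι) (n : ι → N) (s : S) :
    tmul R (∑ i ∈ t, n i) s = ∑ i ∈ t, tmul R (n i) s :=
  map_sum (AddMonoidHom.mk' (tmul R · s) fun n n' => add_tmul n n' s) n t

theorem tmul_sum {ι : Type*} (t : Finset ι) (n : N) (s : ι → S) :
    tmul R n (∑ i ∈ t, s i) = ∑ i ∈ t, tmul R n (s i) :=
  map_sum (AddMonoidHom.mk' (tmul R n) (tmul_add n)) s t

theorem map_map (f : N →ₗ[Rᵐᵒᵖ] N') (g : S →ₗ[R] S') (f' : N' →ₗ[Rᵐᵒᵖ] N'')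
    (g' : S' →ₗ[R] S'') (t : BalancedTensor R N S) :
    map f' g' (map f g t) = map (f' ∘ₗ f) (g' ∘ₗ g) t :=
  DFunLike.congr_fun (hom_ext fun _ _ => rfl :
    (map f' g').comp (map f g) = map (f' ∘ₗ f) (g' ∘ₗ g)) t

theorem map_id (t : BalancedTensor R N S) : map LinearMap.id LinearMap.id t = t :=
  DFunLike.congr_fun (hom_ext fun _ _ => rfl :
    map LinearMap.id LinearMap.id = AddMonoidHom.id (BalancedTensor R N S)) t

theorem map_add_left (f f' : N →ₗ[Rᵐᵒᵖ] N') (g : S →ₗ[R] S') :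
    map (f + f') g = map f g + map f' g :=
  hom_ext fun _ _ => add_tmul _ _ _

theorem map_add_right (f : N →ₗ[Rᵐᵒᵖ] N') (g g' : S →ₗ[R] S') :
    map f (g + g') = map f g + map f g' :=
  hom_ext fun _ _ => tmul_add _ _ _

theorem map_zero_left (g : S →ₗ[R] S') : map (0 : N →ₗ[Rᵐᵒᵖ] N') g = 0 :=
  hom_ext fun _ _ => zero_tmul _

theorem map_zero_right (f : N →ₗ[Rᵐᵒᵖ] N') : map f (0 : S →ₗ[R] S') = 0 :=
  hom_ext fun _ _ => tmul_zero _

theorem map_surjective {f : N →ₗ[Rᵐᵒᵖ] N'} {g : S →ₗ[R] S'} (hf : Function.Surjective f)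
    (hg : Function.Surjective g) : Function.Surjective (map f g) := by
  intro t
  obtain ⟨τ, rfl⟩ := QuotientAddGroup.mk_surjective t
  obtain ⟨σ, rfl⟩ := TensorProduct.map_surjective (g := f.toAddMonoidHom.toIntLinearMap)
    (g' := g.toAddMonoidHom.toIntLinearMap) hf hg τ
  exact ⟨QuotientAddGroup.mk σ, rfl⟩

theorem balancedRel_le_map {f : N →ₗ[Rᵐᵒᵖ] N'} {g : S →ₗ[R] S'} (hf : Function.Surjective f)
    (hg : Function.Surjective g) :
    balancedRel R N' S' ≤ (balancedRel R N S).map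
      (TensorProduct.map f.toAddMonoidHom.toIntLinearMap
        g.toAddMonoidHom.toIntLinearMap).toAddMonoidHom := by
  rw [balancedRel, AddSubgroup.closure_le]
  rintro _ ⟨n, r, s, rfl⟩
  obtain ⟨n, rfl⟩ := hf n
  obtain ⟨s, rfl⟩ := hg s
  exact ⟨_, AddSubgroup.subset_closure ⟨n, r, s, rfl⟩, by simp⟩

theorem ker_map_le_closure {f : N →ₗ[Rᵐᵒᵖ] N'} {g : S →ₗ[R] S'} (hf : Function.Surjective f)
    (hg : Function.Surjective g) :
    (map f g).ker ≤
      AddSubgroup.closure {t | ∃ (n : N) (s : S), (f n = 0 ∨ g s = 0) ∧ tmul R n s = t} := by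
  set Q := AddSubgroup.closure {t | ∃ (n : N) (s : S), (f n = 0 ∨ g s = 0) ∧ tmul R n s = t}
  have hker : LinearMap.ker (TensorProduct.map f.toAddMonoidHom.toIntLinearMap
      g.toAddMonoidHom.toIntLinearMap) ≤
        AddSubgroup.toIntSubmodule (Q.comap (QuotientAddGroup.mk' (balancedRel R N S))) := by
    rw [TensorProduct.map_ker (LinearMap.exact_subtype_ker_map f.toAddMonoidHom.toIntLinearMap) hf
      (LinearMap.exact_subtype_ker_map g.toAddMonoidHom.toIntLinearMap) hg, LinearMap.lTensor,
      LinearMap.rTensor, TensorProduct.range_map_eq_span_tmul,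
      TensorProduct.range_map_eq_span_tmul]
    refine sup_le (Submodule.span_le.2 ?_) (Submodule.span_le.2 ?_)
    · rintro _ ⟨n, s, rfl⟩
      exact AddSubgroup.subset_closure ⟨n, s, .inr s.2, rfl⟩
    · rintro _ ⟨n, s, rfl⟩
      exact AddSubgroup.subset_closure ⟨n, s, .inl n.2, rfl⟩
  intro t ht
  obtain ⟨τ, rfl⟩ := QuotientAddGroup.mk_surjective t
  obtain ⟨σ, hσ, hτσ⟩ := balancedRel_le_map hf hg ((QuotientAddGroup.eq_zero_iff _).1 ht)
  have hQ : QuotientAddGroup.mk' (balancedRel R N S) (τ - σ) ∈ Q :=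
    hker ((map_sub _ τ σ).trans (sub_eq_zero.2 hτσ.symm))
  have hσ0 : QuotientAddGroup.mk' (balancedRel R N S) σ = 0 := (QuotientAddGroup.eq_zero_iff σ).2 hσ
  rwa [map_sub, hσ0, sub_zero] at hQ

theorem exact_map_left {g : N →ₗ[Rᵐᵒᵖ] N'} {π : N' →ₗ[Rᵐᵒᵖ] N''} (hgπ : Function.Exact g π)
    (hπ : Function.Surjective π) :
    Function.Exact (map g (LinearMap.id : S →ₗ[R] S)) (map π LinearMap.id) := by
  refine fun t => ⟨fun ht => ?_, ?_⟩
  · refine (AddSubgroup.closure_le (map g (LinearMap.id : S →ₗ[R] S)).range).2 ?_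
      (ker_map_le_closure hπ Function.surjective_id ht)
    rintro _ ⟨n, s, hn | rfl, rfl⟩
    · obtain ⟨n, rfl⟩ := (hgπ n).1 hn
      exact ⟨tmul R n s, rfl⟩
    · exact ⟨0, (map_zero _).trans (tmul_zero n).symm⟩
  · rintro ⟨t, rfl⟩
    rw [map_map, hgπ.linearMap_comp_eq_zero, map_zero_left, AddMonoidHom.zero_apply]

theorem exact_map_right {g : S →ₗ[R] S'} {π : S' →ₗ[R] S''} (hgπ : Function.Exact g π)
    (hπ : Function.Surjective π) :
    Function.Exact (map (LinearMap.id : N →ₗ[Rᵐᵒᵖ] N) g) (map LinearMap.id π) := by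
  refine fun t => ⟨fun ht => ?_, ?_⟩
  · refine (AddSubgroup.closure_le (map (LinearMap.id : N →ₗ[Rᵐᵒᵖ] N) g).range).2 ?_
      (ker_map_le_closure Function.surjective_id hπ ht)
    rintro _ ⟨n, s, rfl | hs, rfl⟩
    · exact ⟨0, (map_zero _).trans (zero_tmul s).symm⟩
    · obtain ⟨s, rfl⟩ := (hgπ s).1 hs
      exact ⟨tmul R n s, rfl⟩
  · rintro ⟨t, rfl⟩
    rw [map_map, hgπ.linearMap_comp_eq_zero, map_zero_right, AddMonoidHom.zero_apply]

/-- The homomorphism on `N ⊗_R S` induced by a balanced biadditive map. -/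
def lift {G : Type*} [AddCommGroup G] (φ : N →+ S →+ G)
    (h : ∀ n (r : R) s, φ (MulOpposite.op r • n) s = φ n (r • s)) : BalancedTensor R N S →+ G :=
  QuotientAddGroup.lift _ (TensorProduct.liftAddHom φ (by simp)) (by
    rw [balancedRel, AddSubgroup.closure_le]
    rintro _ ⟨n, r, s, rfl⟩
    simp [h])

variable (R N S) in
/-- The homomorphism `N ⊗_R R → N`, `n ⊗ r ↦ n · r`. -/
def rid : BalancedTensor R N R →+ N :=
  lift (AddMonoidHom.mk' (fun n => AddMonoidHom.mk' (fun r => MulOpposite.op r • n) fun r r' => by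
      rw [MulOpposite.op_add, add_smul]) fun n n' => AddMonoidHom.ext fun r => smul_add _ n n')
    fun n r s => by simp [smul_smul]

variable (R S) in
/-- The homomorphism `R ⊗_R S → S`, `r ⊗ s ↦ r • s`. -/
def lid : BalancedTensor R Rᵐᵒᵖ S →+ S :=
  lift (AddMonoidHom.mk' (fun r => AddMonoidHom.mk' (fun s => r.unop • s) fun s s' =>
      smul_add _ s s') fun r r' => AddMonoidHom.ext fun s => add_smul r.unop r'.unop s)
    fun n r s => by simp [smul_smul]

theorem rid_map (f : N →ₗ[Rᵐᵒᵖ] N') (t : BalancedTensor R N R) :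
    rid R N' (map f LinearMap.id t) = f (rid R N t) :=
  DFunLike.congr_fun (hom_ext fun n r => (map_smul f (MulOpposite.op r) n).symm :
    (rid R N').comp (map f LinearMap.id) = f.toAddMonoidHom.comp (rid R N)) t

theorem lid_map (g : S →ₗ[R] S') (t : BalancedTensor R Rᵐᵒᵖ S) :
    lid R S' (map LinearMap.id g t) = g (lid R S t) :=
  DFunLike.congr_fun (hom_ext fun r s => (map_smul g r.unop s).symm :
    (lid R S').comp (map LinearMap.id g) = g.toAddMonoidHom.comp (lid R S)) t

variable (R) (ι : Type) [Fintype ι] [DecidableEq ι]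

/-- The canonical element `∑ i, eᵢ ⊗ eᵢ` of the tensor product of the free right and left modules
on `ι`: tensors in `Rᶥ ⊗_R S` and in `N ⊗_R Rᶥ` are the images of this one under homomorphisms
`Rᶥ → S` and `Rᶥ → N`. -/
def coev : BalancedTensor R (ι → Rᵐᵒᵖ) (ι → R) :=
  ∑ i, tmul R (Pi.single i 1) (Pi.single i 1)

variable {R ι}

theorem map_coev (φ : (ι → Rᵐᵒᵖ) →ₗ[Rᵐᵒᵖ] N) (Y : (ι → R) →ₗ[R] S) :
    map φ Y (coev R ι) = ∑ i, tmul R (φ (Pi.single i 1)) (Y (Pi.single i 1)) :=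
  map_sum (map φ Y) _ _

theorem exists_map_id_coev_eq (t : BalancedTensor R (ι → Rᵐᵒᵖ) S) :
    ∃ Y : (ι → R) →ₗ[R] S, map LinearMap.id Y (coev R ι) = t := by
  let coord (i : ι) : BalancedTensor R (ι → Rᵐᵒᵖ) S →+ S :=
    (lid R S).comp (map (LinearMap.proj i) LinearMap.id)
  have hsum : ∑ i, (AddMonoidHom.mk' (tmul R (Pi.single i 1)) (tmul_add _)).comp (coord i) =
      AddMonoidHom.id (BalancedTensor R (ι → Rᵐᵒᵖ) S) := by
    refine hom_ext fun n s => ?_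
    rw [AddMonoidHom.finsetSum_apply]
    calc ∑ i, tmul R (Pi.single i 1) ((n i).unop • s)
        = ∑ i, tmul R (n i • Pi.single i 1) s := by simp only [← smul_tmul, MulOpposite.op_unop]
      _ = tmul R n s := by rw [← sum_tmul, ← pi_eq_sum_univ' n]
  refine ⟨Fintype.linearCombination R fun i => coord i t, ?_⟩
  rw [map_coev]
  simpa using DFunLike.congr_fun hsum t

theorem exists_map_coev_id_eq (t : BalancedTensor R N (ι → R)) :
    ∃ φ : (ι → Rᵐᵒᵖ) →ₗ[Rᵐᵒᵖ] N, map φ LinearMap.id (coev R ι) = t := by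
  let coord (i : ι) : BalancedTensor R N (ι → R) →+ N :=
    (rid R N).comp (map LinearMap.id (LinearMap.proj i))
  have hsum : ∑ i, (AddMonoidHom.mk' (tmul R · (Pi.single i 1)) fun n n' => add_tmul n n' _).comp
      (coord i) = AddMonoidHom.id (BalancedTensor R N (ι → R)) := by
    refine hom_ext fun n s => ?_
    rw [AddMonoidHom.finsetSum_apply]
    calc ∑ i, tmul R (MulOpposite.op (s i) • n) (Pi.single i 1)
        = ∑ i, tmul R n (s i • Pi.single i 1) := by simp only [smul_tmul]
      _ = tmul R n s := by rw [← tmul_sum, ← pi_eq_sum_univ' s]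
  refine ⟨Fintype.linearCombination Rᵐᵒᵖ fun i => coord i t, ?_⟩
  rw [map_coev]
  simpa using DFunLike.congr_fun hsum t

theorem lid_map_proj_coev (i : ι) :
    lid R (ι → R) (map (LinearMap.proj i) LinearMap.id (coev R ι)) = Pi.single i 1 := by
  rw [map_coev, map_sum]
  calc ∑ j, ((Pi.single j 1 : ι → Rᵐᵒᵖ) i).unop • (Pi.single j 1 : ι → R)
      = ∑ j, if i = j then Pi.single j 1 else 0 := Finset.sum_congr rfl fun j _ => by
        rw [Pi.single_apply]
        split_ifs <;> simp
    _ = Pi.single i 1 := by simp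

theorem rid_map_proj_coev (i : ι) :
    rid R (ι → Rᵐᵒᵖ) (map LinearMap.id (LinearMap.proj i) (coev R ι)) = Pi.single i 1 := by
  rw [map_coev, map_sum]
  calc ∑ j, MulOpposite.op ((Pi.single j 1 : ι → R) i) • (Pi.single j 1 : ι → Rᵐᵒᵖ)
      = ∑ j, if i = j then Pi.single j 1 else 0 := Finset.sum_congr rfl fun j _ => by
        rw [Pi.single_apply]
        split_ifs <;> simp
    _ = Pi.single i 1 := by simp

theorem map_id_coev_injective :
    Function.Injective fun Y : (ι → R) →ₗ[R] S => map LinearMap.id Y (coev R ι) := by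
  have hcoord (Y : (ι → R) →ₗ[R] S) (i : ι) :
      Y (Pi.single i 1) = lid R S (map (LinearMap.proj i) LinearMap.id
        (map LinearMap.id Y (coev R ι))) := by
    rw [← lid_map_proj_coev i, ← lid_map, map_map, map_map]
    rfl
  refine fun Y Z h => LinearMap.pi_ext' fun i => LinearMap.ext_ring ?_
  change Y (Pi.single i 1) = Z (Pi.single i 1)
  rw [hcoord, hcoord]
  exact congrArg _ (congrArg _ h)

theorem map_coev_id_injective :
    Function.Injective fun φ : (ι → Rᵐᵒᵖ) →ₗ[Rᵐᵒᵖ] N => map φ LinearMap.id (coev R ι) := by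
  have hcoord (φ : (ι → Rᵐᵒᵖ) →ₗ[Rᵐᵒᵖ] N) (i : ι) :
      φ (Pi.single i 1) = rid R N (map LinearMap.id (LinearMap.proj i)
        (map φ LinearMap.id (coev R ι))) := by
    rw [← rid_map_proj_coev i, ← rid_map, map_map, map_map]
    rfl
  refine fun φ ψ h => LinearMap.pi_ext' fun i => LinearMap.ext_ring ?_
  change φ (Pi.single i 1) = ψ (Pi.single i 1)
  rw [hcoord, hcoord]
  exact congrArg _ (congrArg _ h)

end BalancedTensor
end BalancedTensor

section FinitePresentation

theorem exists_comp_eq_of_exact {T K L P N : Type*} [Ring T] [AddCommGroup K] [Module T K]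
    [AddCommGroup L] [Module T L] [AddCommGroup P] [Module T P] [AddCommGroup N] [Module T N]
    {g : K →ₗ[T] L} {π : L →ₗ[T] P} (hgπ : Function.Exact g π) (hπ : Function.Surjective π)
    {φ : L →ₗ[T] N} (hφ : φ ∘ₗ g = 0) : ∃ f : P →ₗ[T] N, f ∘ₗ π = φ := by
  have hker : LinearMap.ker π ≤ LinearMap.ker φ := by
    rw [hgπ.linearMap_ker_eq]
    exact LinearMap.range_le_ker_iff.2 hφ
  refine ⟨(LinearMap.ker π).liftQ φ hker ∘ₗ (π.quotKerEquivOfSurjective hπ).symm, ?_⟩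
  ext x
  simp [LinearMap.quotKerEquivOfSurjective_symm_apply]

namespace BalancedTensor

variable {R : Type u} [Ring R] {N P S A B : Type u} [AddCommGroup N] [Module Rᵐᵒᵖ N]
  [AddCommGroup P] [Module Rᵐᵒᵖ P] [AddCommGroup S] [Module R S] [AddCommGroup A] [Module R A]
  [AddCommGroup B] [Module R B]

theorem map_coev_of_transpose {ι κ : Type} [Fintype ι] [DecidableEq ι] [Fintype κ] [DecidableEq κ]
    {g : (κ → Rᵐᵒᵖ) →ₗ[Rᵐᵒᵖ] (ι → Rᵐᵒᵖ)} {g' : (ι → R) →ₗ[R] (κ → R)}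
    (hg : map LinearMap.id g' (coev R ι) = map g LinearMap.id (coev R κ))
    (φ : (ι → Rᵐᵒᵖ) →ₗ[Rᵐᵒᵖ] N) (Y : (κ → R) →ₗ[R] S) :
    map φ (Y ∘ₗ g') (coev R ι) = map (φ ∘ₗ g) Y (coev R κ) := by
  simpa only [map_map, LinearMap.comp_id] using congrArg (map φ Y) hg

theorem eq_zero_of_forall_map_proj_eq_zero [Module.FinitePresentation Rᵐᵒᵖ P] {I : Type u}
    {S : I → Type u} [∀ i, AddCommGroup (S i)] [∀ i, Module R (S i)]
    {t : BalancedTensor R P (∀ i, S i)}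
    (ht : ∀ i, map LinearMap.id (LinearMap.proj (R := R) i) t = 0) : t = 0 := by
  obtain ⟨n, m, π, g, hπ, hgπ⟩ := Module.FinitePresentation.exists_fin' Rᵐᵒᵖ P
  obtain ⟨τ, rfl⟩ := map_surjective (g := LinearMap.id) hπ Function.surjective_id t
  obtain ⟨Y, rfl⟩ := exists_map_id_coev_eq τ
  obtain ⟨g', hg'⟩ := exists_map_id_coev_eq (map g LinearMap.id (coev R (Fin m)))
  have hZ (i : I) : ∃ Z : (Fin m → R) →ₗ[R] S i, Z ∘ₗ g' = LinearMap.proj i ∘ₗ Y := by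
    have hi : map π LinearMap.id
        (map LinearMap.id (LinearMap.proj i ∘ₗ Y) (coev R (Fin n))) = 0 := by
      simpa only [map_map, LinearMap.comp_id, LinearMap.id_comp] using ht i
    obtain ⟨τ, hτ⟩ := (exact_map_left hgπ hπ _).1 hi
    obtain ⟨Z, rfl⟩ := exists_map_id_coev_eq τ
    refine ⟨Z, map_id_coev_injective ((map_coev_of_transpose hg' _ Z).trans ?_)⟩
    simpa only [map_map, LinearMap.comp_id, LinearMap.id_comp] using hτ
  choose Z hZ using hZ
  have hY : LinearMap.pi Z ∘ₗ g' = Y := LinearMap.ext fun x => funext fun i =>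
    DFunLike.congr_fun (hZ i) x
  rw [map_map, ← hY, LinearMap.comp_id, LinearMap.id_comp, map_coev_of_transpose hg',
    hgπ.linearMap_comp_eq_zero, map_zero_left, AddMonoidHom.zero_apply]

section Prod

variable {ι κ κ' : Type} [Fintype ι] [DecidableEq ι] [Fintype κ] [DecidableEq κ] [Fintype κ']
  [DecidableEq κ']

theorem map_coev_mkQ_inl_eq_zero {g : (κ → Rᵐᵒᵖ) →ₗ[Rᵐᵒᵖ] (ι → Rᵐᵒᵖ)}
    {g' : (ι → R) →ₗ[R] (κ → R)}
    (hg : map LinearMap.id g' (coev R ι) = map g LinearMap.id (coev R κ))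
    {π : (ι → Rᵐᵒᵖ) →ₗ[Rᵐᵒᵖ] P} (hπ : π ∘ₗ g = 0) (Y : (ι → R) →ₗ[R] A) :
    map π ((LinearMap.range (Y.prod g')).mkQ ∘ₗ LinearMap.inl R A (κ → R) ∘ₗ Y) (coev R ι) = 0 := by
  set q := (LinearMap.range (Y.prod g')).mkQ
  have hq : q ∘ₗ LinearMap.inl R A (κ → R) ∘ₗ Y + (q ∘ₗ LinearMap.inr R A (κ → R)) ∘ₗ g' = 0 := by
    rw [← LinearMap.range_mkQ_comp (Y.prod g')]
    ext
    simp [q, ← Submodule.Quotient.mk_add]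
  have h := DFunLike.congr_fun (congrArg (map π) hq) (coev R ι)
  rwa [map_add_right, AddMonoidHom.add_apply, map_coev_of_transpose hg, hπ, map_zero_left,
    map_zero_right, AddMonoidHom.zero_apply, AddMonoidHom.zero_apply, add_zero] at h

theorem exists_map_coev_eq_of_map_mkQ_inl_eq_zero {g : (κ → Rᵐᵒᵖ) →ₗ[Rᵐᵒᵖ] (ι → Rᵐᵒᵖ)}
    {g' : (ι → R) →ₗ[R] (κ → R)}
    (hg : map LinearMap.id g' (coev R ι) = map g LinearMap.id (coev R κ))
    {Y : (ι → R) →ₗ[R] A} {t : BalancedTensor R N A}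
    (ht : map LinearMap.id ((LinearMap.range (Y.prod g')).mkQ ∘ₗ LinearMap.inl R A (κ → R)) t = 0) :
    ∃ φ : (ι → Rᵐᵒᵖ) →ₗ[Rᵐᵒᵖ] N, φ ∘ₗ g = 0 ∧ map φ Y (coev R ι) = t := by
  obtain ⟨u, hu⟩ := (exact_map_right (LinearMap.exact_map_mkQ_range (Y.prod g'))
    (Submodule.mkQ_surjective _) (map LinearMap.id (LinearMap.inl R A (κ → R)) t)).1
      ((map_map _ _ _ _ _).trans ht)
  obtain ⟨φ, rfl⟩ := exists_map_coev_id_eq u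
  have hfst := congrArg (map LinearMap.id (LinearMap.fst R A (κ → R))) hu
  have hsnd := congrArg (map LinearMap.id (LinearMap.snd R A (κ → R))) hu
  simp only [map_map, LinearMap.comp_id, LinearMap.id_comp, LinearMap.fst_prod,
    LinearMap.fst_comp_inl, map_id] at hfst
  simp only [map_map, LinearMap.comp_id, LinearMap.id_comp, LinearMap.snd_prod,
    LinearMap.snd_comp_inl, map_zero_right, AddMonoidHom.zero_apply] at hsnd
  refine ⟨φ, map_coev_id_injective ?_, hfst⟩
  refine (map_coev_of_transpose hg φ LinearMap.id).symm.trans (hsnd.trans ?_)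
  simp only [map_zero_left, AddMonoidHom.zero_apply]

theorem map_coev_mkQ_inl_eq_zero_iff {g : (κ → Rᵐᵒᵖ) →ₗ[Rᵐᵒᵖ] (ι → Rᵐᵒᵖ)}
    {g' : (ι → R) →ₗ[R] (κ → R)} {z : (κ → Rᵐᵒᵖ) →ₗ[Rᵐᵒᵖ] (κ' → Rᵐᵒᵖ)}
    {z' : (κ' → R) →ₗ[R] (κ → R)}
    (hg : map LinearMap.id g' (coev R ι) = map g LinearMap.id (coev R κ))
    (hz : map LinearMap.id z' (coev R κ') = map z LinearMap.id (coev R κ)) (X : (ι → R) →ₗ[R] S) :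
    map ((LinearMap.range (g.prod z)).mkQ ∘ₗ LinearMap.inl Rᵐᵒᵖ (ι → Rᵐᵒᵖ) (κ' → Rᵐᵒᵖ)) X
        (coev R ι) = 0 ↔
      ∃ Y : (κ → R) →ₗ[R] S, Y ∘ₗ g' = X ∧ Y ∘ₗ z' = 0 := by
  have hexact := exact_map_left (S := S) (LinearMap.exact_map_mkQ_range (g.prod z))
    (Submodule.mkQ_surjective _)
    (map (LinearMap.inl Rᵐᵒᵖ (ι → Rᵐᵒᵖ) (κ' → Rᵐᵒᵖ)) X (coev R ι))
  rw [map_map, LinearMap.id_comp] at hexact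
  refine hexact.trans ⟨?_, ?_⟩
  · rintro ⟨u, hu⟩
    obtain ⟨Y, rfl⟩ := exists_map_id_coev_eq u
    have hfst := congrArg (map (LinearMap.fst Rᵐᵒᵖ (ι → Rᵐᵒᵖ) (κ' → Rᵐᵒᵖ)) LinearMap.id) hu
    have hsnd := congrArg (map (LinearMap.snd Rᵐᵒᵖ (ι → Rᵐᵒᵖ) (κ' → Rᵐᵒᵖ)) LinearMap.id) hu
    simp only [map_map, LinearMap.comp_id, LinearMap.id_comp, LinearMap.fst_prod,
      LinearMap.fst_comp_inl] at hfst
    simp only [map_map, LinearMap.comp_id, LinearMap.id_comp, LinearMap.snd_prod,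
      LinearMap.snd_comp_inl, map_zero_left, AddMonoidHom.zero_apply] at hsnd
    refine ⟨Y, map_id_coev_injective ((map_coev_of_transpose hg _ Y).trans hfst),
      map_id_coev_injective ((map_coev_of_transpose hz _ Y).trans (hsnd.trans ?_))⟩
    simp only [map_zero_right, AddMonoidHom.zero_apply]
  · rintro ⟨Y, rfl, hY⟩
    refine ⟨map LinearMap.id Y (coev R κ), ?_⟩
    have hgz : g.prod z = LinearMap.inl Rᵐᵒᵖ (ι → Rᵐᵒᵖ) (κ' → Rᵐᵒᵖ) ∘ₗ g +
        LinearMap.inr Rᵐᵒᵖ (ι → Rᵐᵒᵖ) (κ' → Rᵐᵒᵖ) ∘ₗ z := by ext <;> simp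
    rw [map_map, LinearMap.id_comp, LinearMap.comp_id, hgz, map_add_left, AddMonoidHom.add_apply,
      ← map_coev_of_transpose hg, ← map_coev_of_transpose hz, hY, map_zero_right,
      AddMonoidHom.zero_apply, add_zero]

end Prod

/- Let `t` be the image of `coev` under `π : Rᶥ → P` and `Y : Rᶥ → A`, and let `g'` be the transpose
of a map `g : Rᵏ → Rᶥ` with image `ker π`. Then `A → (A × Rᵏ) / (Y, g') Rᶥ` kills `t`, and the
elements of `N ⊗ A` that it kills are the images of `t` under maps `P → N`. -/
theorem exists_map_eq_of_forall_map_eq_zero [Module.FinitePresentation Rᵐᵒᵖ P]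
    {t : BalancedTensor R P A} {t' : BalancedTensor R N A}
    (ht : ∀ (S : Type u) [AddCommGroup S] [Module R S] (h : A →ₗ[R] S),
      map LinearMap.id h t = 0 → map LinearMap.id h t' = 0) :
    ∃ f : P →ₗ[Rᵐᵒᵖ] N, map f LinearMap.id t = t' := by
  obtain ⟨n, m, π, g, hπ, hgπ⟩ := Module.FinitePresentation.exists_fin' Rᵐᵒᵖ P
  obtain ⟨τ, rfl⟩ := map_surjective (g := LinearMap.id) hπ Function.surjective_id t
  obtain ⟨Y, rfl⟩ := exists_map_id_coev_eq τ
  obtain ⟨g', hg'⟩ := exists_map_id_coev_eq (map g LinearMap.id (coev R (Fin m)))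
  simp only [map_map, LinearMap.comp_id, LinearMap.id_comp] at ht ⊢
  obtain ⟨φ, hφg, rfl⟩ := exists_map_coev_eq_of_map_mkQ_inl_eq_zero hg'
    (ht _ _ (map_coev_mkQ_inl_eq_zero hg' hgπ.linearMap_comp_eq_zero Y))
  obtain ⟨f, rfl⟩ := exists_comp_eq_of_exact hgπ hπ hφg
  exact ⟨f, rfl⟩

theorem exists_finitePresentation_tensor [Module.Finite R A] [Module.FinitePresentation R B]
    (g : A →ₗ[R] B) :
    ∃ (P : Type u) (_ : AddCommGroup P) (_ : Module Rᵐᵒᵖ P) (_ : Module.FinitePresentation Rᵐᵒᵖ P)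
      (t : BalancedTensor R P A), ∀ (S : Type u) [AddCommGroup S] [Module R S] (h : A →ₗ[R] S),
        map LinearMap.id h t = 0 ↔ ∃ k : B →ₗ[R] S, k ∘ₗ g = h := by
  obtain ⟨l, α, hα⟩ := Module.Finite.exists_fin' R A
  obtain ⟨n, m, π, z, hπ, hzπ⟩ := Module.FinitePresentation.exists_fin' R B
  obtain ⟨q, hq⟩ := Module.projective_lifting_property π (g ∘ₗ α) hπ
  obtain ⟨q', hq'⟩ := exists_map_coev_id_eq (map LinearMap.id q (coev R (Fin l)))
  obtain ⟨z', hz'⟩ := exists_map_coev_id_eq (map LinearMap.id z (coev R (Fin m)))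
  refine ⟨_, _, _, finitePresentation_quotient_range (q'.prod z'),
    map ((LinearMap.range (q'.prod z')).mkQ ∘ₗ LinearMap.inl _ _ _) α (coev R (Fin l)),
    fun S _ _ h => ?_⟩
  rw [map_map, LinearMap.id_comp, map_coev_mkQ_inl_eq_zero_iff hq'.symm hz'.symm]
  refine ⟨?_, ?_⟩
  · rintro ⟨Y, hYq, hYz⟩
    obtain ⟨k, rfl⟩ := exists_comp_eq_of_exact hzπ hπ hYz
    refine ⟨k, (LinearMap.cancel_right hα).1 ?_⟩
    rw [← hYq, LinearMap.comp_assoc, LinearMap.comp_assoc, hq]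
  · rintro ⟨k, rfl⟩
    refine ⟨k ∘ₗ π, ?_, ?_⟩
    · rw [LinearMap.comp_assoc, LinearMap.comp_assoc, hq]
    · rw [LinearMap.comp_assoc, hzπ.linearMap_comp_eq_zero, LinearMap.comp_zero]

end BalancedTensor

end FinitePresentation

section Generators

variable {R : Type u} [Ring R] {F G : ModuleCat.{u} R ⥤ AddCommGrpCat.{u}}

/-- The element `y` generates `F`: its images under the maps `F.map h` are all the elements of `F`.
For additive `F` this means that the subfunctor generated by `y` is `F`. -/
def Generates (F : ModuleCat.{u} R ⥤ AddCommGrpCat.{u}) {A : ModuleCat.{u} R} (y : F.obj A) :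
    Prop :=
  ∀ (S : ModuleCat.{u} R) (z : F.obj S), ∃ h : A ⟶ S, F.map h y = z

theorem eq_zero_of_app_eq_zero (w : F ⟶ G) [Mono w] {S : ModuleCat.{u} R} {z : F.obj S}
    (hz : w.app S z = 0) : z = 0 :=
  (AddCommGrpCat.mono_iff_injective (w.app S)).1 inferInstance
    (hz.trans (map_zero (w.app S).hom).symm)

theorem mono_of_forall_eq_zero (w : F ⟶ G)
    (hw : ∀ (S : ModuleCat.{u} R) (z : F.obj S), w.app S z = 0 → z = 0) : Mono w :=
  have (S : ModuleCat.{u} R) : Mono (w.app S) :=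
    (AddCommGrpCat.mono_iff_injective _).2 ((injective_iff_map_eq_zero (w.app S).hom).2 (hw S))
  NatTrans.mono_of_mono_app w

theorem toProd_map {I : Type u} (S : I → ModuleCat.{u} R) {A : ModuleCat.{u} R}
    (h : ∀ i, A ⟶ S i) (y : F.obj A) (i : I) :
    toProd F S (F.map (ModuleCat.ofHom (LinearMap.pi fun i => (h i).hom)) y) i = F.map (h i) y :=
  (map_comp_apply _ _ y).symm

theorem toProd_app (w : F ⟶ G) {I : Type u} (S : I → ModuleCat.{u} R)
    (x : F.obj (ModuleCat.of R (∀ i, S i))) (i : I) :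
    toProd G S (w.app _ x) i = w.app _ (toProd F S x i) :=
  (NatTrans.naturality_apply w _ x).symm

theorem injective_toProd_iff {I : Type u} {S : I → ModuleCat.{u} R} :
    Function.Injective (toProd F S) ↔ ∀ x, (∀ i, toProd F S x i = 0) → x = 0 := by
  refine ⟨fun h x hx => h ?_, fun h x x' hx => sub_eq_zero.1 (h _ fun i => ?_)⟩
  · exact funext fun i => (hx i).trans (map_zero (F.map _).hom).symm
  · exact (map_sub (F.map _).hom x x').trans (sub_eq_zero.2 (congrFun hx i))

theorem IsFP.isML (hF : IsFP F) : IsML F :=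
  ⟨hF.additive, hF.preservesDirectLimits, fun S => (hF.bijective_toProd S).injective⟩

/- By bijectivity of `toProd`, one element of `F` at a product of the modules `fpModule i` projects
to all the elements of all the groups `F.obj (fpModule i)`. -/
theorem IsFP.exists_generates (hF : IsFP F) :
    ∃ (i : FPIndex R) (y : F.obj (fpModule i)), Generates F y := by
  obtain ⟨Y, hY⟩ := (hF.bijective_toProd
    fun t : Σ i : FPIndex R, F.obj (fpModule i) => fpModule t.1).surjective fun t => t.2
  obtain ⟨i, k, y, rfl⟩ := hF.preservesDirectLimits.exists_fpModule_rep _ Y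
  refine ⟨i, y, fun S z => ?_⟩
  obtain ⟨j, k', b, rfl⟩ := hF.preservesDirectLimits.exists_fpModule_rep S z
  refine ⟨k ≫ ModuleCat.ofHom (LinearMap.proj (⟨j, b⟩ : Σ i : FPIndex R, F.obj (fpModule i))) ≫ k',
    ?_⟩
  rw [map_comp_apply, map_comp_apply]
  exact congrArg (F.map k') (congrFun hY ⟨j, b⟩)

theorem IsML.exists_annihilator (hF : IsML F) {A : ModuleCat.{u} R} [IsFinitelyPresentable.{u} A]
    (y : F.obj A) :
    ∃ (i : FPIndex R) (g : A ⟶ fpModule i), ∀ (S : ModuleCat.{u} R) (h : A ⟶ S),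
      F.map h y = 0 ↔ ∃ k : fpModule i ⟶ S, g ≫ k = h := by
  let T : (Σ i : FPIndex R, {h : A ⟶ fpModule i // F.map h y = 0}) → ModuleCat.{u} R :=
    fun t => fpModule t.1
  let H : A ⟶ ModuleCat.of R (∀ t, T t) := ModuleCat.ofHom (LinearMap.pi fun t => t.2.1.hom)
  have hH : F.map H y = 0 := injective_toProd_iff.1 (hF.injective_toProd T) _ fun t =>
    (toProd_map T (fun t => t.2.1) y t).trans t.2.2
  obtain ⟨i, g, k, hgk, hg⟩ := hF.preservesDirectLimits.exists_fpModule_factor H y hH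
  refine ⟨i, g, fun S h => ⟨fun hh => ?_, ?_⟩⟩
  · obtain ⟨j, g', k', rfl, hg'⟩ := hF.preservesDirectLimits.exists_fpModule_factor h y hh
    let p : ModuleCat.of R (∀ t, T t) ⟶ fpModule j :=
      ModuleCat.ofHom (LinearMap.proj (⟨j, g', hg'⟩ : Σ i, {h : A ⟶ fpModule i // F.map h y = 0}))
    have hp : H ≫ p = g' := rfl
    exact ⟨k ≫ p ≫ k', by rw [reassoc_of% hgk, reassoc_of% hp]⟩
  · rintro ⟨k, rfl⟩
    rw [map_comp_apply, hg, map_zero]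

theorem map_eq_map_of_forall_map_eq_zero [F.Additive] [G.Additive] {A : ModuleCat.{u} R}
    {y : F.obj A} {t : G.obj A}
    (ht : ∀ (S : ModuleCat.{u} R) (h : A ⟶ S), F.map h y = 0 → G.map h t = 0)
    {S : ModuleCat.{u} R} {h h' : A ⟶ S} (hh : F.map h y = F.map h' y) :
    G.map h t = G.map h' t := by
  have hsub := ht S (h - h') (by
    rw [F.map_sub]
    exact sub_eq_zero.2 hh)
  rw [G.map_sub] at hsub
  exact sub_eq_zero.1 hsub

theorem Generates.exists_hom [F.Additive] [G.Additive] {A : ModuleCat.{u} R} {y : F.obj A}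
    (hy : Generates F y) {t : G.obj A}
    (ht : ∀ (S : ModuleCat.{u} R) (h : A ⟶ S), F.map h y = 0 → G.map h t = 0) :
    ∃ w : F ⟶ G, w.app A y = t := by
  choose r hr using hy
  have hmap {S : ModuleCat.{u} R} {h h' : A ⟶ S} (hh : F.map h y = F.map h' y) :
      G.map h t = G.map h' t := map_eq_map_of_forall_map_eq_zero ht hh
  refine ⟨{
    app S := AddCommGrpCat.ofHom (AddMonoidHom.mk' (fun z => G.map (r S z) t) fun z z' => ?_)
    naturality S S' f := ?_ }, ?_⟩
  · have hadd : F.map (r S (z + z')) y = F.map (r S z + r S z') y := by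
      rw [hr, F.map_add]
      exact congrArg₂ (· + ·) (hr S z).symm (hr S z').symm
    refine (hmap hadd).trans ?_
    rw [G.map_add]
    rfl
  · refine ConcreteCategory.hom_ext _ _ fun z => (hmap ?_).trans (map_comp_apply (r S z) f t)
    rw [hr, map_comp_apply, hr]
    rfl
  · refine (hmap (h' := 𝟙 A) ?_).trans ?_
    · rw [hr, F.map_id]
      rfl
    · rw [G.map_id]
      rfl

instance (N : ModuleCat.{u} Rᵐᵒᵖ) : ((quasiCoherent R).obj N).Additive where
  map_add {S S' g g'} := by
    ext1
    exact BalancedTensor.hom_ext fun _ _ => BalancedTensor.tmul_add _ _ _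

theorem Generates.mono {A : ModuleCat.{u} R} {y : F.obj A} (hy : Generates F y)
    {w : F ⟶ G}
    (hw : ∀ (S : ModuleCat.{u} R) (h : A ⟶ S), G.map h (w.app A y) = 0 → F.map h y = 0) :
    Mono w := by
  refine mono_of_forall_eq_zero w fun S z hz => ?_
  obtain ⟨h, rfl⟩ := hy S z
  exact hw S h ((NatTrans.naturality_apply w h y).symm.trans hz)

theorem IsFP.exists_mono_quasiCoherent (hF : IsFP F) :
    ∃ (P : ModuleCat.{u} Rᵐᵒᵖ) (w : F ⟶ (quasiCoherent R).obj P),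
      Module.FinitePresentation Rᵐᵒᵖ P ∧ Mono w := by
  have := hF.additive
  obtain ⟨i, y, hy⟩ := hF.exists_generates
  obtain ⟨j, g, hg⟩ := hF.isML.exists_annihilator y
  obtain ⟨P, _, _, hP, t, ht⟩ := BalancedTensor.exists_finitePresentation_tensor g.hom
  have hmap (S : ModuleCat.{u} R) (h : fpModule i ⟶ S) :
      F.map h y = 0 ↔ ((quasiCoherent R).obj (ModuleCat.of Rᵐᵒᵖ P)).map h t = 0 := by
    refine (hg S h).trans (Iff.trans ?_ (ht S h.hom).symm)
    exact ⟨fun ⟨k, hk⟩ => ⟨k.hom, congrArg ModuleCat.Hom.hom hk⟩,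
      fun ⟨k, hk⟩ => ⟨ModuleCat.ofHom k, ModuleCat.hom_ext hk⟩⟩
  obtain ⟨w, rfl⟩ := hy.exists_hom (G := (quasiCoherent R).obj (ModuleCat.of Rᵐᵒᵖ P))
    fun S h => (hmap S h).1
  exact ⟨_, w, hP, hy.mono fun S h => (hmap S h).2⟩

theorem Generates.hom_ext {A : ModuleCat.{u} R} {y : F.obj A} (hy : Generates F y) {w v : F ⟶ G}
    (h : w.app A y = v.app A y) : w = v := by
  ext S z
  obtain ⟨k, rfl⟩ := hy S z
  rw [NatTrans.naturality_apply, NatTrans.naturality_apply, h]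

theorem Generates.exists_comp_quasiCoherent_map_eq {A : ModuleCat.{u} R} {y : F.obj A}
    (hy : Generates F y) {P N : ModuleCat.{u} Rᵐᵒᵖ} [Module.FinitePresentation Rᵐᵒᵖ P]
    (w : F ⟶ (quasiCoherent R).obj P) [Mono w] (v : F ⟶ (quasiCoherent R).obj N) :
    ∃ f : P ⟶ N, w ≫ (quasiCoherent R).map f = v := by
  obtain ⟨f, hf⟩ := BalancedTensor.exists_map_eq_of_forall_map_eq_zero
    (t := w.app A y) (t' := v.app A y) fun S _ _ h ht => by
      have hz : F.map (ModuleCat.ofHom h) y = 0 :=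
        eq_zero_of_app_eq_zero w ((NatTrans.naturality_apply w (ModuleCat.ofHom h) y).trans ht)
      refine (NatTrans.naturality_apply v (ModuleCat.ofHom h) y).symm.trans ?_
      rw [hz]
      exact map_zero (v.app _).hom
  exact ⟨ModuleCat.ofHom f, hy.hom_ext hf⟩

theorem injective_toProd_quasiCoherent (P : ModuleCat.{u} Rᵐᵒᵖ) [Module.FinitePresentation Rᵐᵒᵖ P]
    {I : Type u} (S : I → ModuleCat.{u} R) :
    Function.Injective (toProd ((quasiCoherent R).obj P) S) :=
  injective_toProd_iff.2 fun _ => BalancedTensor.eq_zero_of_forall_map_proj_eq_zero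

end Generators

section Compactness

variable {R : Type u} [Ring R] {F : ModuleCat.{u} R ⥤ AddCommGrpCat.{u}}

/-- The morphisms `w j` have no common nonzero element in their kernels. -/
def JointlyInjective {J : Type*} {G : J → ModuleCat.{u} R ⥤ AddCommGrpCat.{u}}
    (w : ∀ j, F ⟶ G j) : Prop :=
  ∀ (S : ModuleCat.{u} R) (z : F.obj S), (∀ j, (w j).app S z = 0) → z = 0

section TailProduct

variable {I : Type u} [Preorder I]

/-- The direct system of the modules `∏ i' ≥ i, S i'`, whose transition maps are the projections.
Its direct limit is the module of germs at infinity of families in `∏ i, S i`. -/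
def tailProduct (S : I → ModuleCat.{u} R) : I ⥤ ModuleCat.{u} R where
  obj i := ModuleCat.of R (∀ i' : Set.Ici i, S i')
  map {i j} f := ModuleCat.ofHom (LinearMap.pi fun i' : Set.Ici j =>
    (LinearMap.proj (⟨i', f.le.trans i'.2⟩ : Set.Ici i) : (∀ i' : Set.Ici i, S i') →ₗ[R] S i'))

variable (S : I → ModuleCat.{u} R)

/-- The projection of `∏ i' ≥ i, S i'` onto its factor `S j`. -/
def tailProductπ {i j : I} (h : i ≤ j) : (tailProduct S).obj i ⟶ S j :=
  ModuleCat.ofHom (LinearMap.proj (⟨j, h⟩ : Set.Ici i) : (∀ i' : Set.Ici i, S i') →ₗ[R] S j)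

theorem tailProduct_map_π {i j k : I} (f : i ⟶ j) (h : j ≤ k) :
    (tailProduct S).map f ≫ tailProductπ S h = tailProductπ S (f.le.trans h) :=
  rfl

theorem eq_of_forall_map_tailProductπ_eq
    (hF : ∀ {I : Type u} (S : I → ModuleCat.{u} R), Function.Injective (toProd F S)) {i : I}
    {x x' : F.obj ((tailProduct S).obj i)}
    (h : ∀ (j : I) (hij : i ≤ j), F.map (tailProductπ S hij) x = F.map (tailProductπ S hij) x') :
    x = x' :=
  hF (fun i' : Set.Ici i => S i') (funext fun i' => h i' i'.2)

variable {S}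

theorem IsFP.exists_tailProduct_family (hF : IsFP F) (z : ∀ i, F.obj (S i)) :
    ∃ y : ∀ i, F.obj ((tailProduct S).obj i),
      (∀ ⦃i j : I⦄ (h : i ≤ j), F.map (tailProductπ S h) (y i) = z j) ∧
        ∀ ⦃i j : I⦄ (f : i ⟶ j), F.map ((tailProduct S).map f) (y i) = y j := by
  have hex (i : I) : ∃ y : F.obj ((tailProduct S).obj i),
      ∀ (j : I) (h : i ≤ j), F.map (tailProductπ S h) y = z j := by
    obtain ⟨y, hy⟩ := (hF.bijective_toProd fun i' : Set.Ici i => S i').surjective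
      fun i' : Set.Ici i => z i'
    exact ⟨y, fun j h => congrFun hy ⟨j, h⟩⟩
  choose y hy using hex
  refine ⟨y, fun i j h => hy i j h, fun i j f =>
    eq_of_forall_map_tailProductπ_eq S hF.isML.injective_toProd fun k h => ?_⟩
  rw [← map_comp_apply, tailProduct_map_π, hy, hy]

theorem IsFP.exists_eq_zero_of_eventually (hF : IsFP F) [IsDirectedOrder I] [Nonempty I] {J : Type*}
    {G : J → ModuleCat.{u} R ⥤ AddCommGrpCat.{u}}
    (hG : ∀ j {I : Type u} (S : I → ModuleCat.{u} R), Function.Injective (toProd (G j) S))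
    {w : ∀ j, F ⟶ G j} (hw : JointlyInjective w) (z : ∀ i, F.obj (S i))
    (hz : ∀ j, ∀ᶠ i in Filter.atTop, (w j).app (S i) (z i) = 0) : ∃ i, z i = 0 := by
  obtain ⟨y, hyz, hy⟩ := hF.exists_tailProduct_family z
  have hι {i i' : I} (f : i ⟶ i') : F.map (colimit.ι (tailProduct S) i) (y i) =
      F.map (colimit.ι (tailProduct S) i') (y i') := by
    rw [← hy f, ← map_comp_apply, colimit.w]
  obtain ⟨i₀⟩ := ‹Nonempty I›
  have hy₀ : F.map (colimit.ι (tailProduct S) i₀) (y i₀) = 0 := by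
    refine hw _ _ fun j => ?_
    obtain ⟨i, hi⟩ := Filter.eventually_atTop.1 (hz j)
    obtain ⟨k, hik, hk⟩ := exists_ge_ge i i₀
    have hyk : (w j).app _ (y k) = 0 := by
      refine eq_of_forall_map_tailProductπ_eq S (hG j) fun i' hi' => ?_
      rw [← NatTrans.naturality_apply, hyz, hi i' (hik.trans hi'), map_zero]
    rw [hι (homOfLE hk), NatTrans.naturality_apply, hyk, map_zero]
  have := hF.preservesDirectLimits I
  obtain ⟨k, f, hk⟩ := exists_map_eq_zero_of_isColimit
    (isColimitOfPreserves F (colimit.isColimit (tailProduct S))) (y i₀) hy₀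
  have hyk : y k = 0 := (hy f).symm.trans hk
  exact ⟨k, by rw [← hyz le_rfl, hyk, map_zero]⟩

end TailProduct

theorem IsFP.exists_finset_jointlyInjective (hF : IsFP F) {J : Type u}
    {G : J → ModuleCat.{u} R ⥤ AddCommGrpCat.{u}}
    (hG : ∀ j {I : Type u} (S : I → ModuleCat.{u} R), Function.Injective (toProd (G j) S))
    {w : ∀ j, F ⟶ G j} (hw : JointlyInjective w) :
    ∃ E : Finset J, JointlyInjective fun j : E => w j := by
  classical
  by_contra! hE
  simp only [JointlyInjective, not_forall] at hE
  choose S z hz hz₀ using hE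
  obtain ⟨E, hE⟩ := hF.exists_eq_zero_of_eventually hG hw z fun j =>
    (Filter.eventually_ge_atTop {j}).mono fun E hjE =>
      hz E ⟨j, Finset.singleton_subset_iff.1 hjE⟩
  exact hz₀ E hE

end Compactness

section DirectedColimit

theorem isColimit_of_elementwise_addCommGrp {I : Type u} [Preorder I] [IsDirectedOrder I]
    [Nonempty I] {D : I ⥤ AddCommGrpCat.{u}} (c : Cocone D)
    (hsurj : ∀ x : c.pt, ∃ i, ∃ y : D.obj i, c.ι.app i y = x)
    (hinj : ∀ i (y : D.obj i), c.ι.app i y = 0 → ∃ (j : I) (f : i ⟶ j), D.map f y = 0) :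
    Nonempty (IsColimit c) := by
  have : ReflectsColimitsOfShape I (forget AddCommGrpCat.{u}) :=
    reflectsColimitsOfShape_of_reflectsIsomorphisms
  refine ⟨isColimitOfReflects (forget AddCommGrpCat.{u})
    (Types.FilteredColimit.isColimitOf' _ _ (fun x => ?_) fun i x y h => ?_)⟩
  · obtain ⟨i, y, rfl⟩ := hsurj x
    exact ⟨i, y, rfl⟩
  · obtain ⟨j, f, hf⟩ := hinj i (x - y : D.obj i)
      ((map_sub (c.ι.app i).hom _ _).trans (sub_eq_zero.2 h))
    exact ⟨j, f, sub_eq_zero.1 ((map_sub (D.map f).hom _ _).symm.trans hf)⟩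

end DirectedColimit

noncomputable section CyclicSubfunctor

variable {R : Type u} [Ring R] (M : ModuleCat.{u} R ⥤ AddCommGrpCat.{u}) [M.Additive]
  {A : ModuleCat.{u} R}

/-- The values on `S` of the subfunctor of `M` generated by `x`. -/
def cyclicAddSubgroup (x : M.obj A) (S : ModuleCat.{u} R) : AddSubgroup (M.obj S) :=
  AddMonoidHom.range (AddMonoidHom.mk' (fun h : A ⟶ S => M.map h x) fun h h' => by
    rw [M.map_add]
    rfl)

/-- The subfunctor of `M` generated by `x`, i.e. the image of the morphism `Hom(A, -) ⟶ M`
corresponding to `x`. -/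
def cyclicSubfunctor (x : M.obj A) : ModuleCat.{u} R ⥤ AddCommGrpCat.{u} where
  obj S := AddCommGrpCat.of (cyclicAddSubgroup M x S)
  map {S S'} f := AddCommGrpCat.ofHom
    (((M.map f).hom.comp (cyclicAddSubgroup M x S).subtype).codRestrict
      (cyclicAddSubgroup M x S') (by
        rintro ⟨_, h, rfl⟩
        exact ⟨h ≫ f, map_comp_apply _ _ _⟩))
  map_id S := by
    ext1
    exact AddMonoidHom.ext fun z => Subtype.ext (ConcreteCategory.congr_hom (M.map_id S) z.1)
  map_comp f g := by
    ext1
    exact AddMonoidHom.ext fun z => Subtype.ext (ConcreteCategory.congr_hom (M.map_comp f g) z.1)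

/-- The inclusion in `M` of the subfunctor generated by `x`. -/
def cyclicSubfunctorι (x : M.obj A) : cyclicSubfunctor M x ⟶ M where
  app S := AddCommGrpCat.ofHom (cyclicAddSubgroup M x S).subtype

variable {M}

instance (x : M.obj A) : Mono (cyclicSubfunctorι M x) :=
  mono_of_forall_eq_zero _ fun _ _ hz => Subtype.ext hz

instance (x : M.obj A) : (cyclicSubfunctor M x).Additive where
  map_add {S S' f g} := by
    ext z
    refine Subtype.ext ?_
    change M.map (f + g) z.1 = M.map f z.1 + M.map g z.1
    rw [M.map_add]
    rfl

theorem PreservesDirectLimits.cyclicSubfunctor (hM : PreservesDirectLimits M)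
    [IsFinitelyPresentable.{u} A] (x : M.obj A) :
    PreservesDirectLimits (cyclicSubfunctor M x) :=
  fun I _ _ _ => ⟨fun {D} => ⟨fun {c} hc => by
    have := hM I
    refine isColimit_of_elementwise_addCommGrp _ ?_ fun i y hy => ?_
    · rintro ⟨_, h, rfl⟩
      obtain ⟨i, g, rfl⟩ := IsFinitelyPresentable.exists_hom_of_isColimit hc h
      exact ⟨i, ⟨M.map g x, g, rfl⟩, Subtype.ext (map_comp_apply _ _ _).symm⟩
    · obtain ⟨j, f, hf⟩ := exists_map_eq_zero_of_isColimit (isColimitOfPreserves M hc) (j := i) y.1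
        (congrArg Subtype.val hy)
      exact ⟨j, f, Subtype.ext hf⟩⟩⟩

theorem bijective_toProd_cyclicSubfunctor (x : M.obj A) {I : Type u} {S : I → ModuleCat.{u} R}
    (hM : Function.Injective (toProd M S)) :
    Function.Bijective (toProd (cyclicSubfunctor M x) S) := by
  refine ⟨fun z z' h => ?_, fun z => ?_⟩
  · exact Subtype.ext (hM (funext fun i => congrArg Subtype.val (congrFun h i)))
  · choose h hh using fun i => (z i).2
    refine ⟨⟨_, ModuleCat.ofHom (LinearMap.pi fun i => (h i).hom), rfl⟩, funext fun i => ?_⟩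
    exact Subtype.ext ((toProd_map S h x i).trans (hh i))

theorem IsML.isFP_cyclicSubfunctor (hM : IsML M) [IsFinitelyPresentable.{u} A] (x : M.obj A) :
    IsFP (cyclicSubfunctor M x) where
  additive := inferInstance
  preservesDirectLimits := hM.preservesDirectLimits.cyclicSubfunctor x
  bijective_toProd S := bijective_toProd_cyclicSubfunctor x (hM.injective_toProd S)

end CyclicSubfunctor

noncomputable section CyclicSystem

variable {R : Type u} [Ring R] {M : ModuleCat.{u} R ⥤ AddCommGrpCat.{u}}

variable (M) in
/-- The elements of the groups `M.obj (fpModule i)`, preordered by: `s ≤ t` when `s` is the image of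
`t` under some morphism, so that the subfunctor of `M` generated by `s` is contained in that
generated by `t`. -/
def ElementIndex : Type u := Σ i : FPIndex R, M.obj (fpModule i)

instance : Preorder (ElementIndex M) where
  le s t := ∃ g : fpModule t.1 ⟶ fpModule s.1, M.map g t.2 = s.2
  le_refl s := ⟨𝟙 _, by rw [M.map_id]; rfl⟩
  le_trans s t r := by
    rintro ⟨g, hg⟩ ⟨g', hg'⟩
    exact ⟨g' ≫ g, by rw [map_comp_apply, hg', hg]⟩

theorem PreservesDirectLimits.nonempty_elementIndex (hM : PreservesDirectLimits M) :
    Nonempty (ElementIndex M) := by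
  obtain ⟨i, -, x, -⟩ := hM.exists_fpModule_rep (ModuleCat.of R R) 0
  exact ⟨i, x⟩

/- The element `(s, t)` of the value of `M` at the direct sum of the two modules projects to `s` and
to `t`. -/
theorem PreservesDirectLimits.isDirectedOrder_elementIndex [M.Additive]
    (hM : PreservesDirectLimits M) : IsDirectedOrder (ElementIndex M) where
  directed s t := by
    obtain ⟨i, g, x, hg⟩ := hM.exists_fpModule_rep (fpModule s.1 ⊞ fpModule t.1)
      (M.map biprod.inl s.2 + M.map biprod.inr t.2)
    refine ⟨⟨i, x⟩, ⟨g ≫ biprod.fst, ?_⟩, ⟨g ≫ biprod.snd, ?_⟩⟩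
    · rw [map_comp_apply, hg, map_add, ← map_comp_apply, ← map_comp_apply, biprod.inl_fst,
        biprod.inr_fst, M.map_id, M.map_zero]
      exact add_zero _
    · rw [map_comp_apply, hg, map_add, ← map_comp_apply, ← map_comp_apply, biprod.inl_snd,
        biprod.inr_snd, M.map_id, M.map_zero]
      exact zero_add _

variable [M.Additive]

theorem cyclicAddSubgroup_mono {s t : ElementIndex M} (h : s ≤ t) (S : ModuleCat.{u} R) :
    cyclicAddSubgroup M s.2 S ≤ cyclicAddSubgroup M t.2 S := by
  obtain ⟨g, hg⟩ := h
  rintro _ ⟨k, rfl⟩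
  exact ⟨g ≫ k, (map_comp_apply g k t.2).trans (congrArg (M.map k) hg)⟩

variable (M) in
/-- The direct system of the subfunctors of `M` generated by one element of its value at some
`fpModule i`. -/
def cyclicSystem : ElementIndex M ⥤ ModuleCat.{u} R ⥤ AddCommGrpCat.{u} where
  obj s := cyclicSubfunctor M s.2
  map f := { app S := AddCommGrpCat.ofHom (AddSubgroup.inclusion (cyclicAddSubgroup_mono f.le S)) }

variable (M) in
/-- The inclusions in `M` of the members of `cyclicSystem M`. -/
def cyclicSystemι : cyclicSystem M ⟶ (Functor.const _).obj M where
  app s := cyclicSubfunctorι M s.2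

theorem PreservesDirectLimits.nonempty_isColimit_cyclicSystem (hM : PreservesDirectLimits M) :
    Nonempty (IsColimit (Cocone.mk M (cyclicSystemι M))) := by
  have := hM.nonempty_elementIndex
  have := hM.isDirectedOrder_elementIndex
  refine ⟨evaluationJointlyReflectsColimits _ fun S => Classical.choice ?_⟩
  refine isColimit_of_elementwise_addCommGrp _ (fun z => ?_) fun s y hy => ?_
  · obtain ⟨i, k, b, rfl⟩ := hM.exists_fpModule_rep S z
    exact ⟨⟨i, b⟩, ⟨_, k, rfl⟩, rfl⟩
  · exact ⟨s, 𝟙 s, Subtype.ext hy⟩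

end CyclicSystem

section Duality

variable {R : Type u} [Ring R] {F M : ModuleCat.{u} R ⥤ AddCommGrpCat.{u}}

theorem epi_dualMap_iff {i : F ⟶ M} : Epi (dualMap i) ↔
    ∀ (N : ModuleCat.{u} Rᵐᵒᵖ) (w : F ⟶ (quasiCoherent R).obj N),
      ∃ v : M ⟶ (quasiCoherent R).obj N, i ≫ v = w := by
  simp only [NatTrans.epi_iff_epi_app, AddCommGrpCat.epi_iff_surjective]
  rfl

namespace JointlyInjective

variable {J : Type*} {G : J → ModuleCat.{u} R ⥤ AddCommGrpCat.{u}} {w : ∀ j, M ⟶ G j}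

theorem mono_comp (hw : JointlyInjective w) (i : F ⟶ M) [Mono i] :
    JointlyInjective fun j => i ≫ w j :=
  fun S _ hz => eq_zero_of_app_eq_zero i (hw S _ hz)

theorem mono_of_comp {g : ∀ j, M ⟶ G j} {v : F ⟶ M} (h : JointlyInjective fun j => v ≫ g j) :
    Mono v :=
  mono_of_forall_eq_zero v fun S z hz => h S z fun j => by
    rw [NatTrans.comp_app, ConcreteCategory.comp_apply, hz, map_zero]

theorem injective_toProd (hw : JointlyInjective w) {I : Type u} {S : I → ModuleCat.{u} R}
    (hG : ∀ j, Function.Injective (toProd (G j) S)) : Function.Injective (toProd M S) :=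
  injective_toProd_iff.2 fun x hx => hw _ x fun j => injective_toProd_iff.1 (hG j) _ fun i => by
    rw [toProd_app, hx, map_zero]

theorem of_isColimit {J : Type u} [SmallCategory J] [IsFiltered J]
    {G : J → ModuleCat.{u} R ⥤ AddCommGrpCat.{u}} {w : ∀ j, M ⟶ G j}
    {D : J ⥤ ModuleCat.{u} R ⥤ AddCommGrpCat.{u}} {ι : D ⟶ (Functor.const J).obj M}
    (hι : IsColimit (Cocone.mk M ι)) (hw : ∀ j, Mono (ι.app j ≫ w j)) : JointlyInjective w := by
  intro S z hz
  obtain ⟨j, y, rfl⟩ := Concrete.isColimit_exists_rep _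
    (isColimitOfPreserves ((evaluation _ _).obj S) hι) z
  have hy : y = 0 := eq_zero_of_app_eq_zero (ι.app j ≫ w j) (hz j)
  rw [hy]
  exact map_zero ((ι.app j).app S).hom

end JointlyInjective

theorem jointlyInjective_comp_π_iff_mono {J : Type u} {G : J → ModuleCat.{u} R ⥤ AddCommGrpCat.{u}}
    {f : M ⟶ ∏ᶜ G} : JointlyInjective (fun j => f ≫ Pi.π G j) ↔ Mono f := by
  refine ⟨JointlyInjective.mono_of_comp, fun _ S z hz => eq_zero_of_app_eq_zero f ?_⟩
  refine Concrete.isLimit_ext _ (isLimitOfPreserves ((evaluation _ _).obj S)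
    (limit.isLimit (Discrete.functor G))) _ _ fun j => ?_
  rw [map_zero]
  exact hz j.as

instance : (quasiCoherent R).Additive where
  map_add := by
    intros
    ext S : 2
    ext1
    exact BalancedTensor.hom_ext fun _ _ => BalancedTensor.add_tmul _ _ _

theorem exists_comp_map_biproduct_π {C D : Type*} [Category C] [Category D]
    [HasZeroMorphisms C] [Preadditive D] (Q : C ⥤ D) [Q.PreservesZeroMorphisms]
    {J : Type*} [Finite J] {P : J → C} [HasBiproduct P] {X : D} (w : ∀ j, X ⟶ Q.obj (P j)) :
    ∃ W : X ⟶ Q.obj (⨁ P), ∀ j, W ≫ Q.map (biproduct.π P j) = w j := by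
  classical
  have := Fintype.ofFinite J
  refine ⟨∑ j, w j ≫ Q.map (biproduct.ι P j), fun j => ?_⟩
  simp only [Preadditive.sum_comp, Category.assoc, ← Q.map_comp]
  rw [Finset.sum_eq_single j (fun k _ hk => ?_) (fun hj => absurd (Finset.mem_univ j) hj)]
  · rw [biproduct.ι_π_self, Q.map_id, Category.comp_id]
  · rw [biproduct.ι_π_ne P hk, Q.map_zero, comp_zero]

theorem IsFP.epi_dualMap (hF : IsFP F) (i : F ⟶ M) {P : ModuleCat.{u} Rᵐᵒᵖ}
    [Module.FinitePresentation Rᵐᵒᵖ P] (W : M ⟶ (quasiCoherent R).obj P) [Mono (i ≫ W)] :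
    Epi (dualMap i) := by
  obtain ⟨_, y, hy⟩ := hF.exists_generates
  refine epi_dualMap_iff.2 fun N v => ?_
  obtain ⟨f, hf⟩ := hy.exists_comp_quasiCoherent_map_eq (i ≫ W) v
  exact ⟨W ≫ (quasiCoherent R).map f, by rw [← Category.assoc, hf]⟩

theorem IsSML.isDirectLimitOfDualEpiFP (hM : IsSML M) : IsDirectLimitOfDualEpiFP M := by
  have := hM.isML.additive
  have hlim := hM.isML.preservesDirectLimits
  refine ⟨ElementIndex M, inferInstance, hlim.isDirectedOrder_elementIndex,
    hlim.nonempty_elementIndex, cyclicSystem M, cyclicSystemι M,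
    hlim.nonempty_isColimit_cyclicSystem, fun s => ?_⟩
  have hFP : IsFP (cyclicSubfunctor M s.2) := hM.isML.isFP_cyclicSubfunctor s.2
  have hmono : Mono (cyclicSubfunctorι M s.2) := inferInstance
  exact ⟨hFP, hmono, hM.epi_dualMap _ _ hmono hFP⟩

theorem IsDirectLimitOfDualEpiFP.embedsInProdFinitelyPresented
    (hM : IsDirectLimitOfDualEpiFP M) : EmbedsInProdFinitelyPresented M := by
  obtain ⟨I, _, _, _, D, ι, ⟨hι⟩, h⟩ := hM
  choose P w hP hw using fun i => (h i).1.exists_mono_quasiCoherent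
  choose v hv using fun i => epi_dualMap_iff.1 (h i).2.2 (P i) (w i)
  have hinj : JointlyInjective v := .of_isColimit hι fun i => (hv i).symm ▸ hw i
  refine ⟨I, P, Pi.lift v, hP, jointlyInjective_comp_π_iff_mono.1 ?_⟩
  simpa only [Pi.lift_π] using hinj

theorem EmbedsInProdFinitelyPresented.isSML [M.Additive] (hlim : PreservesDirectLimits M)
    (hM : EmbedsInProdFinitelyPresented M) : IsSML M := by
  obtain ⟨J, P, f, hP, hf⟩ := hM
  have hw := jointlyInjective_comp_π_iff_mono.2 hf
  have hinj (j : J) {I : Type u} (S : I → ModuleCat.{u} R) :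
      Function.Injective (toProd ((quasiCoherent R).obj (P j)) S) :=
    injective_toProd_quasiCoherent (P j) S
  refine ⟨⟨inferInstance, hlim, fun S => hw.injective_toProd fun j => hinj j S⟩, fun F i _ hF => ?_⟩
  obtain ⟨E, hE⟩ := hF.exists_finset_jointlyInjective hinj (hw.mono_comp i)
  obtain ⟨W, hW⟩ := exists_comp_map_biproduct_π (quasiCoherent R)
    fun j : E => f ≫ Pi.π (fun j => (quasiCoherent R).obj (P j)) j
  have : Mono (i ≫ W) := by
    simp only [← hW, ← Category.assoc] at hE
    exact hE.mono_of_comp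
  have := finitePresentation_biproduct fun j : E => P j
  exact hF.epi_dualMap i W

end Duality

end FunctorialModules

theorem mainTheorem3 {R : Type u} [Ring R]
    (M : CategoryTheory.Functor (ModuleCat.{u} R) AddCommGrpCat.{u}) (hadd : M.Additive)
    (hlim : FunctorialModules.PreservesDirectLimits M) :
    List.TFAE
      [FunctorialModules.IsSML M,
       FunctorialModules.IsDirectLimitOfDualEpiFP M,
       FunctorialModules.EmbedsInProdFinitelyPresented M] := by
  tfae_have 1 → 2 := fun h => h.isDirectLimitOfDualEpiFP
  tfae_have 2 → 3 := fun h => h.embedsInProdFinitelyPresented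
  tfae_have 3 → 1 := fun h => h.isSML hlim
  tfae_finish
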